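/- Consider oriented virtual link diagrams: generic immersions of finitely many oriented circles in the plane, up to plane isotopy, in which every double point is either a virtual crossing or a classical crossing (with over/under information). A flat diagram is such a diagram without over/under information at the classical crossings. Free links are flat links considered up to virtualization (exchanging a classical and a virtual crossing that together form a bigon). The moves are: - the first Reidemeister move: adding or removing a kink with one classical crossing; - the second Reidemeister move: adding or removing a bigon face with two classical crossings (in the virtual case, one strand passes over the other at both crossings). It is called braid-like if the two strands are directed alike along the bigon, and unoriented if they are directed oppositely; - the third Reidemeister move: moving a strand across the opposite crossing of a triangular face with three classical crossings (in the virtual case, one of the three strands is above the other two). It is called braid-like if the boundary of the triangle is not a directed cycle, and unoriented if it is a directed cycle; - the detour move: replacing an arc that contains only virtual crossings (possibly none) by any other arc with the same ends that contains only virtual crossings. Theorem. The unoriented second and third Reidemeister moves cannot be expressed in terms of the braid-like second and third Reidemeister moves, the first Reidemeister move and the detour move. Precisely, for each of the three theories (virtual links, flat links, free links), where virtualization is also allowed in the case of free links: 1. there are diagrams $D,D'$ that differ by a single unoriented second Reidemeister move, but are not related by any finite sequence of first Reidemeister moves, braid-like second and third Reidemeister moves, detour moves and their inverses; 2. there are diagrams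 $D,D'$ that differ by a single unoriented third Reidemeister move, but are not related by any such sequence. -/

import Mathlib

namespace VirtualLinks

/-- The three kinds of knot theory: virtual links, flat virtual links and free links. -/
inductive LinkTheory where
  | virtual
  | flat
  | free

/-- A passage of a strand through the crossing named `c`.  Of the two strands that meet at a
crossing, `(c, true)` is the strand with direction `u` and `(c, false)` the one with direction `v`,
where the pair of directions `(u, v)` is a positive frame of the plane. -/
abbrev Passage : Type := ℕ × Bool

/-- The other passage through the same crossing. -/
def opp (p : Passage) : Passage := (p.1, !p.2)

/-- The data carried by a classical crossing.  For virtual links it names the overpassing strand;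
classical crossings of flat and of free links carry no data. -/
abbrev LinkTheory.Info : LinkTheory → Type
  | .virtual => Bool
  | .flat => Unit
  | .free => Unit

/-- `T.Above i e`: at a classical crossing with data `i` the strand `e` may be regarded as the upper
one.  For flat and free links this is no restriction. -/
def LinkTheory.Above : (T : LinkTheory) → T.Info → Bool → Prop
  | .virtual, i, e => i = e
  | .flat, _, _ => True
  | .free, _, _ => True

/-! ### Planar Gauss codes

An oriented diagram is recorded by the cyclic words of passages met along its components, where both
classical and virtual crossings are recorded. An empty word is a circle without crossings. -/

/-- All passages of a code. -/
def passages (W : List (List Passage)) : List Passage := W.flatten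

/-- The passage that follows a given one along its (cyclic) component. -/
def succ (W : List (List Passage)) : Equiv.Perm Passage := (W.map List.formPerm).prod

/-- The edges of the diagram are the segments from `p` to `succ W p`.  A pair `(p, true)` stands for
the left hand side of this edge, traversed forwards, and `(p, false)` for its right hand side,
traversed backwards.  The boundary of a face, kept on the left, is followed from each edge to the
next one by turning left at the crossing. -/
def faceStep (W : List (List Passage)) : Passage × Bool → Passage × Bool
  | (p, true) =>
      if (succ W p).2 then (opp (succ W p), true)
      else ((succ W).symm (opp (succ W p)), false)
  | (p, false) =>
      if p.2 then ((succ W).symm (opp p), false)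
      else (opp p, true)

/-- The faces of the ribbon graph of a code (circles without crossings are left out). -/
def Face (W : List (List Passage)) : Type :=
  Quot fun s t : {s : Passage × Bool // s.1 ∈ passages W} => faceStep W s.1 = t.1

/-- The connected pieces of the four-valent graph of a code. -/
def Piece (W : List (List Passage)) : Type :=
  Quot fun p q : {p : Passage // p ∈ passages W} => succ W p.1 = q.1 ∨ opp p.1 = q.1

/-- The code is the code of curves in the plane.  With `n` crossings, `2 * n` passages and
`2 * n` edges this is Euler's formula `n - 2 * n + #faces = 2 * #pieces`; since each piece has Euler
characteristic at most `2`, it says that each piece has genus `0`. -/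
def IsPlanar (W : List (List Passage)) : Prop :=
  2 * Nat.card (Face W) = (passages W).length + 4 * Nat.card (Piece W)

/-- An oriented link diagram in the plane (with virtual crossings) of the theory `T`. -/
structure Diagram (T : LinkTheory) where
  /-- one cyclic word of passages for each component -/
  words : List (List Passage)
  /-- `none` for a virtual crossing; the values at names that do not occur have no meaning -/
  info : ℕ → Option T.Info
  nodup : (passages words).Nodup
  opp_mem : ∀ p ∈ passages words, opp p ∈ passages words
  planar : IsPlanar words

variable {T : LinkTheory}

namespace Diagram

/-- `c` is the name of a crossing of `D`. -/
def HasCrossing (D : Diagram T) (c : ℕ) : Prop := (c, true) ∈ passages D.words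

/-- The passage `q` follows immediately after `p` (no classical or virtual crossing between). -/
def Next (D : Diagram T) (p q : Passage) : Prop :=
  p ∈ passages D.words ∧ succ D.words p = q

/-- A bigon face with vertices `x`, `y` whose two sides are directed alike, both from `x` to `y`. -/
def CoherentBigon (D : Diagram T) (x y : ℕ) (r : Bool) : Prop :=
  x ≠ y ∧ D.Next (x, r) (y, !r) ∧ D.Next (x, !r) (y, r)

/-- A bigon face with vertices `x`, `y` whose two sides are directed oppositely. -/
def IncoherentBigon (D : Diagram T) (x y : ℕ) (r : Bool) : Prop :=
  x ≠ y ∧ D.Next (x, r) (y, !r) ∧ D.Next (y, r) (x, !r)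

/-- One of the two strands that form a bigon with vertices `x`, `y` lies above the other one; in
particular both crossings are classical. -/
def BigonLayered (D : Diagram T) (x y : ℕ) (r : Bool) : Prop :=
  ∃ i j, D.info x = some i ∧ D.info y = some j ∧
    ((T.Above i r ∧ T.Above j (!r)) ∨ (T.Above i (!r) ∧ T.Above j r))

/-- `D` arises from `D'` by erasing the crossings with names in `s` (the strands stay). -/
def IsErasure (s : Finset ℕ) (D D' : Diagram T) : Prop :=
  D.words = D'.words.map (fun w => w.filter fun p => p.1 ∉ s) ∧
    ∀ c, D.HasCrossing c → D.info c = D'.info c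

/-- The same diagram, up to the names of the crossings, the order of the components and the starting
points on the components. -/
def Iso (D D' : Diagram T) : Prop :=
  ∃ f : Equiv.Perm ℕ,
    (D.words.map fun w => ((w.map (Prod.map f id) : List Passage) : Cycle Passage)).Perm
      (D'.words.map fun w => (w : Cycle Passage)) ∧
    ∀ c, D.HasCrossing c → D.info c = D'.info (f c)

/-- First Reidemeister move: `D'` is `D` with a classical kink added. -/
def R1 (D D' : Diagram T) : Prop :=
  ∃ (c : ℕ) (r : Bool), D'.Next (c, r) (c, !r) ∧ (∃ i, D'.info c = some i) ∧
    IsErasure {c} D D'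

/-- Braid-like second Reidemeister move (two strands directed alike). -/
def BraidLikeR2 (D D' : Diagram T) : Prop :=
  ∃ (x y : ℕ) (r : Bool), D'.CoherentBigon x y r ∧ D'.BigonLayered x y r ∧
    IsErasure {x, y} D D'

/-- Unoriented second Reidemeister move (two strands directed oppositely). -/
def UnorientedR2 (D D' : Diagram T) : Prop :=
  ∃ (x y : ℕ) (r : Bool), D'.IncoherentBigon x y r ∧ D'.BigonLayered x y r ∧
    IsErasure {x, y} D D'

/-- `D'` arises from `D` by exchanging `p` with `p'`, `q` with `q'` and `s` with `s'`. -/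
def IsTripleSwap (p p' q q' s s' : Passage) (D D' : Diagram T) : Prop :=
  D'.words = D.words.map
      (List.map (Equiv.swap p p' * Equiv.swap q q' * Equiv.swap s s' : Equiv.Perm Passage)) ∧
    ∀ c, D.HasCrossing c → D'.info c = D.info c

/-- Braid-like third Reidemeister move: the boundary of the triangle is not a directed cycle.  The
first strand passes `a` and `b`, the second one `a` and `c`, the third one `b` and `c`.  The last
condition says that one of the strands is above the two others. -/
def BraidLikeR3 (D D' : Diagram T) : Prop :=
  ∃ (a b c : ℕ) (r : Bool), a ≠ b ∧ a ≠ c ∧ b ≠ c ∧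
    D.Next (a, r) (b, r) ∧ D.Next (a, !r) (c, r) ∧ D.Next (b, !r) (c, !r) ∧
    (∃ i j k, D.info a = some i ∧ D.info b = some j ∧ D.info c = some k ∧
      ((T.Above i r ∧ T.Above j r) ∨ (T.Above i (!r) ∧ T.Above k r) ∨
        (T.Above j (!r) ∧ T.Above k (!r)))) ∧
    IsTripleSwap (a, r) (b, r) (a, !r) (c, r) (b, !r) (c, !r) D D'

/-- Unoriented third Reidemeister move: the boundary of the triangle is a directed cycle
`a → b → c → a`. -/
def UnorientedR3 (D D' : Diagram T) : Prop :=
  ∃ (a b c : ℕ) (r : Bool), a ≠ b ∧ a ≠ c ∧ b ≠ c ∧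
    D.Next (a, r) (b, !r) ∧ D.Next (b, r) (c, !r) ∧ D.Next (c, r) (a, !r) ∧
    (∃ i j k, D.info a = some i ∧ D.info b = some j ∧ D.info c = some k ∧
      ((T.Above i r ∧ T.Above j (!r)) ∨ (T.Above j r ∧ T.Above k (!r)) ∨
        (T.Above k r ∧ T.Above i (!r)))) ∧
    IsTripleSwap (a, r) (b, !r) (b, r) (c, !r) (c, r) (a, !r) D D'

/-- The passages of `A` through crossings that are not on the arc `u`. -/
def offArc (u A : List Passage) : List Passage := A.filter fun p => p.1 ∉ u.map Prod.fst

/-- Detour move: an arc `u` that has virtual crossings only (possibly with itself, possibly none) is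
replaced by an arc `u'` with the same ends that has virtual crossings only; the rest of the diagram
does not change. -/
def Detour (D D' : Diagram T) : Prop :=
  ∃ (A u A' u' : List Passage) (L L' : List (List Passage)),
    D.words = (A ++ u) :: L ∧ D'.words = (A' ++ u') :: L' ∧
    (∀ p ∈ u, D.info p.1 = none) ∧ (∀ p ∈ u', D'.info p.1 = none) ∧
    offArc u A = offArc u' A' ∧ L.map (offArc u) = L'.map (offArc u') ∧
    ∀ c, D.HasCrossing c → c ∉ u.map Prod.fst → D.info c = D'.info c

/-- Virtualization: a classical and a virtual crossing that form a bigon are exchanged. -/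
def Virtualization (D D' : Diagram T) : Prop :=
  ∃ (z v : ℕ) (r : Bool), (D.CoherentBigon z v r ∨ D.CoherentBigon v z r ∨
      D.IncoherentBigon z v r) ∧
    (∃ i, D.info z = some i) ∧ D.info v = none ∧
    D'.words = D.words ∧
    ∀ c, D.HasCrossing c → D'.info c = D.info (Equiv.swap z v c)

/-- The moves that are allowed: the first Reidemeister move, the braid-like second and third
Reidemeister moves and the detour move.  Free links are by definition flat links up to
virtualization. -/
inductive BraidLikeMove : Diagram T → Diagram T → Prop
  | iso {D D' : Diagram T} : Iso D D' → BraidLikeMove D D'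
  | r1 {D D' : Diagram T} : R1 D D' → BraidLikeMove D D'
  | r2 {D D' : Diagram T} : BraidLikeR2 D D' → BraidLikeMove D D'
  | r3 {D D' : Diagram T} : BraidLikeR3 D D' → BraidLikeMove D D'
  | detour {D D' : Diagram T} : Detour D D' → BraidLikeMove D D'
  | virtualization {D D' : Diagram T} : T = LinkTheory.free → Virtualization D D' →
      BraidLikeMove D D'

/-- `D'` can be obtained from `D` by finitely many allowed moves and their inverses. -/
def BraidLikeEquivalent (D D' : Diagram T) : Prop :=
  Relation.EqvGen BraidLikeMove D D'

end Diagram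

end VirtualLinks

/-!
Label the components of a diagram by truth values and smooth, following the orientation, every
classical crossing between two strands with the same label. The diagram is even if, for each
labelling, every resulting circle runs an even number of times through a classical crossing of
strands with different labels. Evenness is invariant under all allowed moves. To see this by local
computations, keep track of the parity along the circles: a strand carries its label and a bit, the
bits are exchanged at a crossing of strands with the same label, and both bits are flipped at a
crossing of strands with different labels. Evenness says that each labelling of the components lifts
to a colouring of the diagram by such pairs, and the rule for the crossings satisfies identities that
make colourings correspond to each other under kinks, coherent bigons and acyclic triangles. An
incoherent bigon or a cyclic triangle smooths differently, and each of them can destroy evenness.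
-/

namespace VirtualLinks

variable {Λ X : Type*}

/-- A system of colours for the strands of oriented flat diagrams: a strand of colour `a` that runs
through a crossing with a strand of colour `b` leaves it with colour `out a b`. The label is a
part of the colour that stays constant along each component. The laws are those that colourings need
in order to survive kinks, coherent bigons and acyclic triangles. -/
structure Switch (Λ X : Type*) where
  out : X → X → X
  label : X → Λ
  label_surjective : Function.Surjective label
  label_out : ∀ a b, label (out a b) = label a
  out_self : ∀ a, out a a = a
  out_eq_of_out_eq : ∀ a b, out a b = b → out b a = a
  out_out_out : ∀ a b, out (out a b) (out b a) = a
  braid_outer : ∀ a b c, out (out a b) c = out (out a (out c b)) (out b c)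
  braid_middle : ∀ a b c, out (out b a) (out c (out a b)) = out (out b c) (out a (out c b))

/-- The switch whose colours are pairs of a label and a parity. Exchanging the parities of two
strands with the same label amounts to following the circles of the smoothed diagram. -/
def smoothingSwitch : Switch Bool (Bool × Bool) where
  out a b := if a.1 = b.1 then b else (a.1, !a.2)
  label := Prod.fst
  label_surjective := Prod.fst_surjective
  label_out := by decide
  out_self := by decide
  out_eq_of_out_eq := by decide
  out_out_out := by decide
  braid_outer := by decide
  braid_middle := by decide

/-- The permutation of the passages in a third Reidemeister move on the triangle with vertices `a`,
`b`, `c`: each of the three strands exchanges the order of its two passages. -/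
def triangleSwap (a b c : ℕ) (r : Bool) : Equiv.Perm Passage :=
  Equiv.swap (a, r) (b, r) * Equiv.swap (a, !r) (c, r) * Equiv.swap (b, !r) (c, !r)

section TriangleSwap

variable {a b c : ℕ} {r : Bool}

theorem triangleSwap_apply_of_notMem {p : Passage} (hp : p.1 ∉ ({a, b, c} : Finset ℕ)) :
    triangleSwap a b c r p = p := by
  simp only [Finset.mem_insert, Finset.mem_singleton, not_or] at hp
  obtain ⟨ha, hb, hc⟩ := hp
  have ne {d : ℕ} (hd : p.1 ≠ d) (e : Bool) : p ≠ (d, e) := fun h => hd (h ▸ rfl)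
  simp only [triangleSwap, Equiv.Perm.mul_apply, Equiv.swap_apply_of_ne_of_ne, ne_eq, ne ha, ne hb,
    ne hc, not_false_eq_true]

variable (hab : a ≠ b) (hac : a ≠ c) (hbc : b ≠ c)
include hab hac hbc

theorem triangleSwap_apply :
    triangleSwap a b c r (a, r) = (b, r) ∧ triangleSwap a b c r (a, !r) = (c, r) ∧
      triangleSwap a b c r (b, r) = (a, r) ∧ triangleSwap a b c r (b, !r) = (c, !r) ∧
      triangleSwap a b c r (c, r) = (a, !r) ∧ triangleSwap a b c r (c, !r) = (b, !r) := by
  simp [triangleSwap, Equiv.Perm.mul_apply, Equiv.swap_apply_def, hab, hab.symm, hac, hac.symm, hbc,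
    hbc.symm]

theorem triangleSwap_triangleSwap (p : Passage) :
    triangleSwap a b c r (triangleSwap a b c r p) = p := by
  obtain ⟨ha, ha', hb, hb', hc, hc'⟩ := triangleSwap_apply (r := r) hab hac hbc
  by_cases hp : p.1 ∈ ({a, b, c} : Finset ℕ)
  · obtain ⟨d, e⟩ := p
    simp only [Finset.mem_insert, Finset.mem_singleton] at hp
    obtain rfl | rfl | rfl := hp <;> obtain rfl | rfl := Bool.eq_or_eq_not e r <;>
      simp only [ha, ha', hb, hb', hc, hc']
  · simp only [triangleSwap_apply_of_notMem hp]

theorem triangleSwap_not : triangleSwap c b a (!r) = triangleSwap a b c r := by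
  obtain ⟨ha, ha', hb, hb', hc, hc'⟩ := triangleSwap_apply (r := r) hab hac hbc
  obtain ⟨kc, kc', kb, kb', ka, ka'⟩ := triangleSwap_apply (r := !r) hbc.symm hac.symm hab.symm
  simp only [Bool.not_not] at kc kc' kb kb' ka ka'
  ext1 p
  by_cases hp : p.1 ∈ ({a, b, c} : Finset ℕ)
  · obtain ⟨d, e⟩ := p
    simp only [Finset.mem_insert, Finset.mem_singleton] at hp
    obtain rfl | rfl | rfl := hp <;> obtain rfl | rfl := Bool.eq_or_eq_not e r <;>
      simp only [*]
  · have hp' : p.1 ∉ ({c, b, a} : Finset ℕ) := by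
      simpa only [Finset.mem_insert, Finset.mem_singleton, or_comm, or_left_comm] using hp
    rw [triangleSwap_apply_of_notMem hp, triangleSwap_apply_of_notMem hp']

end TriangleSwap

section SwapMul

variable {α β : Type*} [DecidableEq α]

theorem update_apply_of_apply (g : α → β) (p q : α) : Function.update g p (g q) q = g q := by
  by_cases h : q = p <;> simp [h]

theorem apply_swap_mul {g : α → β} {τ : Equiv.Perm α} {p : α} (hg : g p = g (τ p)) (q : α) :
    g ((Equiv.swap p (τ p) * τ) q) = g (τ q) :=
  Equiv.apply_swap_eq_self hg _

theorem swap_mul_apply_ne {τ : Equiv.Perm α} {p q : α} (hq : q ≠ p) :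
    (Equiv.swap p (τ p) * τ) q ≠ p :=
  fun h => hq ((Equiv.swap p (τ p) * τ).injective (h.trans (by simp)))

theorem update_apply_perm (g : α → β) {τ : Equiv.Perm α} {p q : α} (hq : q ≠ p) :
    Function.update g p (g (τ p)) (τ q) = g ((Equiv.swap p (τ p) * τ) q) := by
  rw [← apply_swap_mul (g := Function.update g p (g (τ p)))
    (by rw [Function.update_self, update_apply_of_apply]),
    Function.update_of_ne (swap_mul_apply_ne hq)]

end SwapMul

namespace Switch

variable (R : Switch Λ X)

/-- The colour after the crossing `c`, where `C` is the set of the classical crossings: virtual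
crossings do not change colours. -/
def cross (C : Finset ℕ) (c : ℕ) (a b : X) : X :=
  if c ∈ C then R.out a b else a

/-- `f p` is the colour of the strand that arrives at the passage `p`, where `σ p` is the next
passage of that strand and `C` is the set of the classical crossings. -/
def IsColouring (σ : Equiv.Perm Passage) (C : Finset ℕ) (f : Passage → X) : Prop :=
  ∀ p, f (σ p) = R.cross C p.1 (f p) (f (opp p))

/-- Every labelling of the components is the labelling of a colouring. -/
def LabellingsLift (σ : Equiv.Perm Passage) (C : Finset ℕ) : Prop :=
  ∀ κ : Passage → Λ, (∀ p, κ (σ p) = κ p) → ∃ f, (∀ p, R.label (f p) = κ p) ∧ R.IsColouring σ C f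

variable {R} {σ σ' : Equiv.Perm Passage} {C C' : Finset ℕ} {f f' : Passage → X} {c x y : ℕ}

theorem cross_of_mem (hc : c ∈ C) (a b : X) : R.cross C c a b = R.out a b :=
  if_pos hc

theorem cross_of_notMem (hc : c ∉ C) (a b : X) : R.cross C c a b = a :=
  if_neg hc

theorem cross_congr (h : c ∈ C' ↔ c ∈ C) (a b : X) : R.cross C' c a b = R.cross C c a b := by
  simp only [cross, h]

theorem label_cross (a b : X) : R.label (R.cross C c a b) = R.label a := by
  unfold cross
  split_ifs
  exacts [R.label_out a b, rfl]

theorem cross_self (a : X) : R.cross C c a a = a := by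
  simp only [cross, R.out_self, ite_self]

theorem cross_eq_of_cross_eq {a b : X} (h : R.cross C c a b = b) : R.cross C c b a = a := by
  unfold cross at *
  split_ifs at *
  exacts [R.out_eq_of_out_eq a b h, h.symm]

theorem IsColouring.label_apply (h : R.IsColouring σ C f) (p : Passage) :
    R.label (f (σ p)) = R.label (f p) := by
  rw [h, label_cross]

theorem IsColouring.apply_of_notMem (h : R.IsColouring σ C f) {p q : Passage} (hσ : σ p = q)
    (hp : p.1 ∉ C) : f q = f p := by
  rw [← hσ, h, cross_of_notMem hp]

theorem IsColouring.of_local (s : Finset ℕ) (h : R.IsColouring σ C f)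
    (hC : ∀ c ∉ s, c ∈ C' ↔ c ∈ C) (hf : ∀ p, p.1 ∉ s → f' p = f p)
    (hσ : ∀ p, p.1 ∉ s → f' (σ' p) = f (σ p))
    (hs : ∀ p, p.1 ∈ s → f' (σ' p) = R.cross C' p.1 (f' p) (f' (opp p))) :
    R.IsColouring σ' C' f' := by
  intro p
  by_cases hp : p.1 ∈ s
  · exact hs p hp
  · rw [hσ p hp, h p, hf p hp, hf (opp p) hp, cross_congr (hC p.1 hp)]

theorem LabellingsLift.of_semiconj (E : Equiv.Perm Passage) (h : R.LabellingsLift σ C)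
    (hE : ∀ p, σ' (E p) = E (σ p))
    (H : ∀ f, R.IsColouring σ C f →
      ∃ f', R.IsColouring σ' C' f' ∧ ∀ p, R.label (f' (E p)) = R.label (f p)) :
    R.LabellingsLift σ' C' := by
  intro κ hκ
  obtain ⟨f, hfκ, hf⟩ := h (fun p => κ (E p)) fun p => by rw [← hE, hκ]
  obtain ⟨f', hf', hlabel⟩ := H f hf
  refine ⟨f', fun p => ?_, hf'⟩
  rw [← E.apply_symm_apply p, hlabel, hfκ]

theorem LabellingsLift.of_relabel (h : R.LabellingsLift σ C)
    (H : ∀ f, R.IsColouring σ C f →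
      ∃ f', R.IsColouring σ C' f' ∧ ∀ p, R.label (f' p) = R.label (f p)) :
    R.LabellingsLift σ C' :=
  h.of_semiconj 1 (fun _ => rfl) H

theorem LabellingsLift.rename {e : Equiv.Perm ℕ} (h : R.LabellingsLift σ C)
    (hσ : ∀ p, σ' (Prod.map e id p) = Prod.map e id (σ p)) (hC : ∀ c, e c ∈ C' ↔ c ∈ C) :
    R.LabellingsLift σ' C' := by
  have he (p : Passage) : Prod.map e.symm id (Prod.map e id p) = p := by
    rw [Prod.map_map, Equiv.symm_comp_self, Function.comp_id, Prod.map_id, id_eq]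
  refine h.of_semiconj (e.prodCongr (Equiv.refl Bool)) hσ fun f hf =>
    ⟨fun p => f (Prod.map e.symm id p), fun p' => ?_, fun p => congrArg (R.label <| f ·) (he p)⟩
  obtain ⟨p, rfl⟩ : ∃ p, Prod.map e id p = p' := (e.prodCongr (Equiv.refl Bool)).surjective p'
  have hopp : opp (Prod.map e id p) = Prod.map e id (opp p) := rfl
  simp only [hσ, hopp, he, Prod.map_fst, cross, hC, hf p]

theorem labellingsLift_rename_iff {e : Equiv.Perm ℕ}
    (hσ : ∀ p, σ' (Prod.map e id p) = Prod.map e id (σ p)) (hC : ∀ c, e c ∈ C' ↔ c ∈ C) :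
    R.LabellingsLift σ' C' ↔ R.LabellingsLift σ C := by
  refine ⟨fun h => h.rename (e := e.symm) (fun p => ?_) fun c => ?_, fun h => h.rename hσ hC⟩
  · have := hσ (Prod.map e.symm id p)
    simp only [Prod.map_map, Equiv.self_comp_symm, Function.comp_id, Prod.map_id, id_eq] at this
    rw [this, Prod.map_map, Equiv.symm_comp_self, Function.comp_id, Prod.map_id, id_eq]
  · rw [← hC, Equiv.apply_symm_apply]

theorem LabellingsLift.kink {r : Bool} (h : R.LabellingsLift σ C) (hσ : σ (c, r) = (c, !r))
    (hC : ∀ d ≠ c, d ∈ C' ↔ d ∈ C) : R.LabellingsLift σ C' := by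
  refine h.of_relabel fun f hf => ?_
  have hfirst : f (c, !r) = R.cross C c (f (c, r)) (f (c, !r)) := by
    conv_lhs => rw [← hσ, hf]
    rfl
  have hsecond : f (σ (c, !r)) = f (c, r) := by
    simpa only [opp, Bool.not_not, cross_eq_of_cross_eq hfirst.symm] using hf (c, !r)
  have hkeep {p : Passage} (hp : p ≠ (c, r)) : σ p ≠ (c, !r) := fun h =>
    hp (σ.injective (h.trans hσ.symm))
  refine ⟨Function.update f (c, !r) (f (c, r)), hf.of_local {c} (by simpa using hC) ?_ ?_ ?_, ?_⟩
  · rintro ⟨d, e⟩ hd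
    exact Function.update_of_ne (by rintro ⟨⟩; simp at hd) ..
  · rintro ⟨d, e⟩ hd
    exact Function.update_of_ne (hkeep (by rintro ⟨⟩; simp at hd)) ..
  · rintro ⟨d, e⟩ hd
    obtain rfl := Finset.mem_singleton.1 hd
    obtain rfl | rfl := Bool.eq_or_eq_not e r
    · simp [hσ, opp, cross_self]
    · simp [hkeep, opp, hsecond, cross_self]
  · intro p
    obtain rfl | hp := eq_or_ne p (c, !r)
    · rw [Function.update_self, ← hsecond, hf.label_apply]
    · rw [Function.update_of_ne hp]

theorem LabellingsLift.coherentBigon (h : R.LabellingsLift σ C) (hxy : x ≠ y)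
    (hσ : ∀ e, σ (x, e) = (y, !e)) (hC : ∀ c ≠ x, c ≠ y → (c ∈ C' ↔ c ∈ C))
    (hR : ∀ a b, R.cross C' y (R.cross C' x a b) (R.cross C' x b a) =
      R.cross C y (R.cross C x a b) (R.cross C x b a)) : R.LabellingsLift σ C' := by
  refine h.of_relabel fun f hf => ?_
  have hx (e : Bool) : f (y, e) = R.cross C x (f (x, !e)) (f (x, e)) := by
    simpa [hσ, opp] using hf (x, !e)
  have hkeep {p : Passage} (hp : p.1 ≠ x) : (σ p).1 ≠ y := fun h =>
    hp (congrArg Prod.fst (σ.injective (show σ p = σ (x, !(σ p).2) by simp [hσ, ← h])))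
  refine ⟨fun p => if p.1 = y then R.cross C' x (f (x, !p.2)) (f (x, p.2)) else f p,
    hf.of_local {x, y} (by simpa using hC) ?_ ?_ ?_, ?_⟩
  · intro p hp
    simp only [Finset.mem_insert, Finset.mem_singleton, not_or] at hp
    exact if_neg hp.2
  · intro p hp
    simp only [Finset.mem_insert, Finset.mem_singleton, not_or] at hp
    exact if_neg (hkeep hp.1)
  · rintro ⟨d, e⟩ hd
    simp only [Finset.mem_insert, Finset.mem_singleton] at hd
    obtain rfl | rfl := hd
    · simp [hσ, opp, hxy]
    · simpa [hkeep (p := (d, e)) hxy.symm, opp, hR, hx] using hf (d, e)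
  · rintro ⟨d, e⟩
    by_cases hd : d = y
    · simp [hd, hx, label_cross]
    · simp [hd]

theorem LabellingsLift.incoherentBigon {r : Bool} (h : R.LabellingsLift σ C) (hxy : x ≠ y)
    (hσx : σ (x, r) = (y, !r)) (hσy : σ (y, r) = (x, !r)) (hx : x ∈ C) (hy : y ∉ C) (hx' : x ∉ C')
    (hy' : y ∈ C') (hC : ∀ c ≠ x, c ≠ y → (c ∈ C' ↔ c ∈ C)) : R.LabellingsLift σ C' := by
  refine h.of_relabel fun f hf => ?_
  have hyf : f (y, !r) = R.out (f (x, r)) (f (x, !r)) := by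
    simpa [hσx, cross_of_mem hx, opp] using hf (x, r)
  have hxf : f (x, !r) = f (y, r) := hf.apply_of_notMem hσy hy
  have hkeep {p : Passage} (hpx : p ≠ (x, r)) (hpy : p ≠ (y, r)) :
      σ p ≠ (y, !r) ∧ σ p ≠ (x, !r) :=
    ⟨fun h => hpx (σ.injective (h.trans hσx.symm)), fun h => hpy (σ.injective (h.trans hσy.symm))⟩
  have hkeep' {p : Passage} (hp : p.1 ∉ ({x, y} : Finset ℕ)) : σ p ≠ (y, !r) ∧ σ p ≠ (x, !r) :=
    hkeep (fun h => by simp [h] at hp) (fun h => by simp [h] at hp)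
  refine ⟨fun p => if p = (y, !r) then f (x, r) else
      if p = (x, !r) then R.out (f (y, r)) (f (x, r)) else f p,
    hf.of_local {x, y} (by simpa using hC) ?_ ?_ ?_, ?_⟩
  · intro p hp
    rw [if_neg, if_neg] <;> exact fun h => by simp [h] at hp
  · intro p hp
    simp [hkeep' hp]
  · rintro ⟨d, e⟩ hd
    simp only [Finset.mem_insert, Finset.mem_singleton] at hd
    obtain rfl | rfl := hd <;> obtain rfl | rfl := Bool.eq_or_eq_not e r
    · simp [hσx, opp, hxy, cross_of_notMem hx']
    · simpa [hkeep, opp, hxy, cross_of_notMem hx', cross_of_mem hx, hxf] using hf (d, !r)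
    · simp [hσy, opp, hxy, hxy.symm, cross_of_mem hy']
    · simpa [hkeep, opp, hxy.symm, cross_of_mem hy', cross_of_notMem hy, hyf, hxf] using hf (d, !r)
  · intro p
    dsimp only
    split_ifs with hpy hpx
    · rw [hpy, hyf, R.label_out]
    · rw [hpx, hxf, R.label_out]
    · rfl

section Triangle

variable (R) in
/-- The colours after a third Reidemeister move on the triangle with vertices `a`, `b`, `c`. The
strand that passed `p` before the move has colour `triangleColouring R a b c r f p` when it arrives
at the image of `p` under `triangleSwap a b c r`. -/
def triangleColouring (a b c : ℕ) (r : Bool) (f : Passage → X) (p : Passage) : X :=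
  if p = (b, r) then R.out (f (a, r)) (R.out (f (b, !r)) (f (a, !r))) else
  if p = (c, r) then R.out (f (a, !r)) (f (b, !r)) else
  if p = (c, !r) then R.out (f (b, !r)) (f (a, !r)) else f p

variable {a b c : ℕ} {r : Bool}

theorem triangleColouring_of_notMem {p : Passage} (hp : p.1 ∉ ({a, b, c} : Finset ℕ)) :
    triangleColouring R a b c r f p = f p := by
  unfold triangleColouring
  rw [if_neg, if_neg, if_neg] <;> exact fun h => by simp [h] at hp

variable (hab : a ≠ b) (hac : a ≠ c) (hbc : b ≠ c)

include hab hac hbc in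
theorem triangleColouring_apply :
    (∀ e, triangleColouring R a b c r f (a, e) = f (a, e)) ∧
      triangleColouring R a b c r f (b, r) =
        R.out (f (a, r)) (R.out (f (b, !r)) (f (a, !r))) ∧
      triangleColouring R a b c r f (b, !r) = f (b, !r) ∧
      triangleColouring R a b c r f (c, r) = R.out (f (a, !r)) (f (b, !r)) ∧
      triangleColouring R a b c r f (c, !r) = R.out (f (b, !r)) (f (a, !r)) := by
  simp [triangleColouring, hab, hac, hbc, hbc.symm]

variable (hσab : σ (a, r) = (b, r)) (hσac : σ (a, !r) = (c, r)) (hσbc : σ (b, !r) = (c, !r))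
include hσab hσac hσbc

theorem triangleColouring_apply_of_ne {p : Passage} (hp : p ≠ (a, r)) (hp' : p ≠ (a, !r))
    (hp'' : p ≠ (b, !r)) : triangleColouring R a b c r f (σ p) = f (σ p) := by
  simp only [triangleColouring, ← hσab, ← hσac, ← hσbc, σ.injective.eq_iff, hp, hp', hp'', if_false]

variable (ha : a ∈ C) (hb : b ∈ C) (hc : c ∈ C)
include ha hb

theorem IsColouring.apply_triangle (hf : R.IsColouring σ C f) :
    f (b, r) = R.out (f (a, r)) (f (a, !r)) ∧ f (c, r) = R.out (f (a, !r)) (f (a, r)) ∧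
      f (c, !r) = R.out (f (b, !r)) (f (b, r)) :=
  ⟨by simpa [hσab, cross_of_mem ha, opp] using hf (a, r),
    by simpa [hσac, cross_of_mem ha, opp] using hf (a, !r),
    by simpa [hσbc, cross_of_mem hb, opp] using hf (b, !r)⟩

theorem IsColouring.label_triangleColouring (hf : R.IsColouring σ C f) (p : Passage) :
    R.label (triangleColouring R a b c r f p) = R.label (f p) := by
  obtain ⟨hfb, hfc, hfc'⟩ := hf.apply_triangle hσab hσac hσbc ha hb
  unfold triangleColouring
  split_ifs with h h h <;> simp only [h, hfb, hfc, hfc', R.label_out]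

include hab hac hbc hc

theorem IsColouring.triangle (hf : R.IsColouring σ C f)
    (hσ' : ∀ p, σ' (triangleSwap a b c r p) = triangleSwap a b c r (σ p)) :
    R.IsColouring σ' C fun p => triangleColouring R a b c r f (triangleSwap a b c r p) := by
  intro p'
  obtain ⟨p, rfl⟩ := (triangleSwap a b c r).surjective p'
  simp only [hσ', triangleSwap_triangleSwap hab hac hbc]
  by_cases hp : p.1 ∈ ({a, b, c} : Finset ℕ)
  · obtain ⟨ta, ta', tb, tb', tc, tc'⟩ := triangleSwap_apply (r := r) hab hac hbc
    obtain ⟨ga, gb, gb', gc, gc'⟩ := triangleColouring_apply (R := R) (r := r) (f := f) hab hac hbc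
    have g_succ := @triangleColouring_apply_of_ne _ _ R σ f a b c r hσab hσac hσbc
    obtain ⟨hfb, hfc, hfc'⟩ := hf.apply_triangle hσab hσac hσbc ha hb
    obtain ⟨d, e⟩ := p
    simp only [Finset.mem_insert, Finset.mem_singleton] at hp
    obtain rfl | rfl | rfl := hp <;> obtain rfl | rfl := Bool.eq_or_eq_not e r
    · simp [hσab, ta, opp, tb', ga, gb, gc', cross_of_mem hb]
    · simp [hσac, ta', opp, tc', ga, gb', gc, cross_of_mem hc]
    · rw [g_succ (by simp [hab.symm]) (by simp [hab.symm]) (by simp), hf]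
      simp only [tb, opp, ta', gb, gc, cross_of_mem ha, cross_of_mem hb, hfb]
      exact R.braid_outer ..
    · simp [hσbc, tb', opp, tc, ga, gb', gc', cross_of_mem hc]
    · rw [g_succ (by simp [hac.symm]) (by simp [hac.symm]) (by simp [hbc.symm]), hf]
      simp only [tc, opp, ta, gb, gc, cross_of_mem ha, cross_of_mem hc, hfb, hfc, hfc',
        Bool.not_not]
      exact R.braid_middle ..
    · rw [g_succ (by simp [hac.symm]) (by simp [hac.symm]) (by simp [hbc.symm]), hf]
      simp only [tc', opp, tb, ga, gc', cross_of_mem hb, cross_of_mem hc, hfb, hfc, hfc',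
        Bool.not_not]
      exact (R.braid_outer ..).symm
  · have hp' : (opp p).1 ∉ ({a, b, c} : Finset ℕ) := hp
    rw [triangleSwap_apply_of_notMem hp, triangleSwap_apply_of_notMem hp',
      triangleColouring_of_notMem hp, triangleColouring_of_notMem hp', ← hf,
      triangleColouring_apply_of_ne hσab hσac hσbc] <;> exact fun h => by simp [h] at hp

theorem LabellingsLift.triangle (h : R.LabellingsLift σ C)
    (hσ' : ∀ p, σ' (triangleSwap a b c r p) = triangleSwap a b c r (σ p)) :
    R.LabellingsLift σ' C :=
  h.of_semiconj (triangleSwap a b c r) hσ' fun _ hf =>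
    ⟨_, hf.triangle hab hac hbc hσab hσac hσbc ha hb hc hσ', fun p => by
      rw [triangleSwap_triangleSwap hab hac hbc,
        hf.label_triangleColouring hσab hσac hσbc ha hb]⟩

theorem labellingsLift_triangle_iff
    (hσ' : ∀ p, σ' (triangleSwap a b c r p) = triangleSwap a b c r (σ p)) :
    R.LabellingsLift σ' C ↔ R.LabellingsLift σ C := by
  refine ⟨fun h => ?_, fun h => h.triangle hab hac hbc hσab hσac hσbc ha hb hc hσ'⟩
  obtain ⟨ta, ta', tb, tb', tc, tc'⟩ := triangleSwap_apply (r := r) hab hac hbc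
  have tt := triangleSwap_triangleSwap (r := r) hab hac hbc
  refine h.triangle (r := !r) hbc.symm hac.symm hab.symm ?_ ?_ ?_ hc hb ha fun p => ?_
  · rw [← tb', hσ', hσbc, tc']
  · rw [Bool.not_not, ← ta', hσ', hσac, tc]
  · rw [Bool.not_not, ← ta, hσ', hσab, tb]
  · rw [triangleSwap_not hab hac hbc, ← tt (σ _), ← hσ', tt]

end Triangle

theorem cross_update {p q : Passage} (hp : p.1 ∉ C) (hq : q ≠ p) (a : X) :
    R.cross C q.1 (Function.update f p a q) (Function.update f p a (opp q)) =
      R.cross C q.1 (f q) (f (opp q)) := by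
  rw [Function.update_of_ne hq]
  by_cases hqp : opp q = p
  · have hqC : q.1 ∉ C := by rwa [← hqp] at hp
    rw [cross_of_notMem hqC, cross_of_notMem hqC]
  · rw [Function.update_of_ne hqp]

/-- Multiplication by the transposition takes the passage `p` out of its cycle. -/
theorem LabellingsLift.of_swap_mul {p : Passage} (hp : p.1 ∉ C)
    (h : R.LabellingsLift (Equiv.swap p (σ p) * σ) C) : R.LabellingsLift σ C := by
  intro κ hκ
  obtain ⟨f, hfκ, hf⟩ := h κ fun q => by rw [apply_swap_mul (hκ p).symm, hκ]
  refine ⟨Function.update f p (f (σ p)), fun q => ?_, fun q => ?_⟩ <;>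
    obtain rfl | hq := eq_or_ne q p
  · rw [Function.update_self, hfκ, hκ]
  · rw [Function.update_of_ne hq, hfκ]
  · rw [update_apply_of_apply, cross_of_notMem hp, Function.update_self]
  · rw [update_apply_perm f hq, hf, cross_update hp hq]

theorem LabellingsLift.swap_mul {p : Passage} (hp : p.1 ∉ C) (h : R.LabellingsLift σ C) :
    R.LabellingsLift (Equiv.swap p (σ p) * σ) C := by
  intro κ hκ
  obtain ⟨f, hfκ, hf⟩ := h (Function.update κ p (κ (σ p))) fun q => by
    obtain rfl | hq := eq_or_ne q p
    · rw [Function.update_self, update_apply_of_apply]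
    · rw [update_apply_perm κ hq, hκ, Function.update_of_ne hq]
  have hfp : f p = f (σ p) := (hf.apply_of_notMem rfl hp).symm
  obtain ⟨a, ha⟩ := R.label_surjective (κ p)
  refine ⟨Function.update f p a, fun q => ?_, fun q => ?_⟩ <;> obtain rfl | hq := eq_or_ne q p
  · rw [Function.update_self, ha]
  · rw [Function.update_of_ne hq, hfκ, Function.update_of_ne hq]
  · rw [Equiv.Perm.mul_apply, Equiv.swap_apply_right, cross_of_notMem hp]
  · rw [Function.update_of_ne (swap_mul_apply_ne hq), apply_swap_mul hfp, hf, cross_update hp hq]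

theorem labellingsLift_swap_mul_iff {p : Passage} (hp : p.1 ∉ C) :
    R.LabellingsLift (Equiv.swap p (σ p) * σ) C ↔ R.LabellingsLift σ C :=
  ⟨.of_swap_mul hp, .swap_mul hp⟩

end Switch

section FormPerm

variable {α : Type*} [DecidableEq α]

theorem swap_self_eq_one (p : α) : Equiv.swap p p = 1 :=
  Equiv.swap_self p

theorem filter_ne_of_notMem {w : List α} {p : α} (hp : p ∉ w) : w.filter (· ≠ p) = w :=
  List.filter_eq_self.2 fun q hq => decide_eq_true fun h : q = p => hp (h ▸ hq)

theorem formPerm_cons {p : α} {l : List α} (hp : p ∉ l) :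
    l.formPerm = Equiv.swap p ((p :: l).formPerm p) * (p :: l).formPerm := by
  cases l with
  | nil => simp only [List.formPerm_nil, List.formPerm_singleton, Equiv.Perm.one_apply, mul_one,
      swap_self_eq_one]
  | cons q l =>
    rw [List.formPerm_cons_cons, Equiv.Perm.mul_apply, List.formPerm_apply_of_notMem hp,
      Equiv.swap_apply_left, Equiv.swap_mul_self_mul]

theorem formPerm_filter_ne {w : List α} (hw : w.Nodup) (p : α) :
    (w.filter (· ≠ p)).formPerm = Equiv.swap p (w.formPerm p) * w.formPerm := by
  by_cases hp : p ∈ w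
  · obtain ⟨l₁, l₂, rfl⟩ := List.append_of_mem hp
    have hrot : (l₁ ++ p :: l₂) ~r (p :: (l₂ ++ l₁)) := List.isRotated_append
    have hpl : p ∉ l₂ ++ l₁ := (List.nodup_cons.1 (hrot.nodup_iff.1 hw)).1
    have hfilter : (l₁ ++ p :: l₂).filter (· ≠ p) = l₁ ++ l₂ := by
      rw [List.filter_append, List.filter_cons_of_neg (by simp), ← List.filter_append,
        filter_ne_of_notMem (by simpa [or_comm] using hpl)]
    rw [hfilter, List.formPerm_eq_of_isRotated (hfilter ▸ hw.filter _) List.isRotated_append,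
      List.formPerm_eq_of_isRotated hw hrot, formPerm_cons hpl]
  · rw [filter_ne_of_notMem hp, List.formPerm_apply_of_notMem hp, swap_self_eq_one, one_mul]

theorem formPerm_map_apply {β : Type*} [DecidableEq β] (E : α ≃ β) (w : List α) (p : α) :
    (w.map E).formPerm (E p) = E (w.formPerm p) := by
  induction w with
  | nil => rfl
  | cons q w ih =>
    cases w with
    | nil => rfl
    | cons q' w =>
      simp only [List.map_cons, List.formPerm_cons_cons, Equiv.Perm.mul_apply] at ih ⊢
      rw [ih, E.injective.swap_apply]

end FormPerm

section Succ

variable {W V : List (List Passage)} {w : List Passage} {p q : Passage}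

theorem mem_passages : p ∈ passages W ↔ ∃ w ∈ W, p ∈ w :=
  List.mem_flatten

theorem passages_map_filter (P : Passage → Bool) :
    passages (W.map (List.filter P)) = (passages W).filter P := by
  simp only [passages, List.filter_flatten]

theorem passages_map_map (E : Passage → Passage) (W : List (List Passage)) :
    passages (W.map (List.map E)) = (passages W).map E := by
  simp only [passages, List.map_flatten]

theorem succ_cons (w : List Passage) (W : List (List Passage)) :
    succ (w :: W) = w.formPerm * succ W := by
  simp only [succ, List.map_cons, List.prod_cons]

theorem succ_apply_of_notMem (hp : p ∉ passages W) : succ W p = p := by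
  induction W with
  | nil => rfl
  | cons w W ih =>
    simp only [passages, List.flatten_cons, List.mem_append, not_or] at hp
    rw [succ_cons, Equiv.Perm.mul_apply, ih hp.2, List.formPerm_apply_of_notMem hp.1]

theorem succ_apply (hW : (passages W).Nodup) (hw : w ∈ W) (hp : p ∈ w) :
    succ W p = w.formPerm p := by
  induction W with
  | nil => cases hw
  | cons v W ih =>
    simp only [passages, List.flatten_cons, List.nodup_append'] at hW
    rw [succ_cons, Equiv.Perm.mul_apply]
    rcases List.mem_cons.1 hw with rfl | hw
    · rw [succ_apply_of_notMem (hW.2.2 hp)]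
    · rw [ih hW.2.1 hw]
      exact List.formPerm_apply_of_notMem fun h =>
        hW.2.2 h (mem_passages.2 ⟨w, hw, List.formPerm_apply_mem_of_mem hp⟩)

theorem nodup_of_mem (hW : (passages W).Nodup) (hw : w ∈ W) : w.Nodup :=
  (List.nodup_flatten.1 hW).1 w hw

theorem succ_mem_iff_of_mem (hW : (passages W).Nodup) (hw : w ∈ W) : succ W p ∈ w ↔ p ∈ w := by
  refine ⟨fun h => ?_, fun h => by rwa [succ_apply hW hw h, List.formPerm_mem_iff_mem]⟩
  obtain ⟨q, hq⟩ := w.formPerm.surjective (succ W p)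
  have hqw : q ∈ w := List.formPerm_mem_iff_mem.1 (hq ▸ h)
  rwa [← (succ W).injective ((succ_apply hW hw hqw).trans hq)]

theorem succ_map_apply (E : Equiv.Perm Passage) (W : List (List Passage)) (p : Passage) :
    succ (W.map (List.map E)) (E p) = E (succ W p) := by
  induction W with
  | nil => rfl
  | cons w W ih =>
    rw [List.map_cons, succ_cons, succ_cons, Equiv.Perm.mul_apply, ih, formPerm_map_apply,
      Equiv.Perm.mul_apply]

theorem mem_passages_iff_cycle :
    p ∈ passages W ↔ ∃ γ ∈ W.map ((↑) : List Passage → Cycle Passage), p ∈ γ := by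
  simp only [mem_passages, List.mem_map, exists_exists_and_eq_and, Cycle.mem_coe_iff]

theorem succ_eq_of_cycle_perm (hV : (passages V).Nodup) (hW : (passages W).Nodup)
    (h : (V.map ((↑) : List Passage → Cycle Passage)).Perm (W.map (↑))) :
    succ V = succ W := by
  ext1 p
  by_cases hp : p ∈ passages V
  · obtain ⟨v, hv, hpv⟩ := mem_passages.1 hp
    obtain ⟨w, hw, hwv⟩ := List.mem_map.1 (h.subset (List.mem_map_of_mem hv))
    have hrot : w ~r v := Cycle.coe_eq_coe.1 hwv
    rw [succ_apply hV hv hpv, succ_apply hW hw (hrot.mem_iff.2 hpv),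
      List.formPerm_eq_of_isRotated (nodup_of_mem hW hw) hrot]
  · have hpW : p ∉ passages W := by simpa only [mem_passages_iff_cycle, h.mem_iff] using hp
    rw [succ_apply_of_notMem hp, succ_apply_of_notMem hpW]

theorem succ_filter_ne (hW : (passages W).Nodup) (p : Passage) :
    succ (W.map (List.filter (· ≠ p))) = Equiv.swap p (succ W p) * succ W := by
  induction W with
  | nil => rw [succ_apply_of_notMem List.not_mem_nil, swap_self_eq_one, one_mul, List.map_nil]
  | cons w W ih =>
    simp only [passages, List.flatten_cons, List.nodup_append'] at hW
    obtain ⟨hw, hW, hdisj⟩ := hW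
    rw [List.map_cons, succ_cons, succ_cons, ih hW, Equiv.Perm.mul_apply]
    by_cases hp : p ∈ w
    · rw [succ_apply_of_notMem (hdisj hp), swap_self_eq_one, one_mul,
        formPerm_filter_ne hw, mul_assoc]
    · rw [filter_ne_of_notMem hp, ← mul_assoc, Equiv.mul_swap_eq_swap_mul, mul_assoc,
        List.formPerm_apply_of_notMem hp]

end Succ

namespace Switch

variable {R : Switch Λ X} {W : List (List Passage)} {C : Finset ℕ}

theorem labellingsLift_filter_notMem_iff (hW : (passages W).Nodup) (E : List Passage)
    (hE : ∀ p ∈ E, p.1 ∉ C) :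
    R.LabellingsLift (succ (W.map (List.filter (· ∉ E)))) C ↔ R.LabellingsLift (succ W) C := by
  induction E with
  | nil =>
    have : (List.filter (· ∉ ([] : List Passage))) = id := by
      funext w
      simp
    rw [this, List.map_id]
  | cons p E ih =>
    have hfilter : (List.filter (· ∉ p :: E) : List Passage → _) =
        List.filter (· ≠ p) ∘ List.filter (· ∉ E) := by
      funext w
      simp [List.filter_filter]
    have hE' := List.forall_mem_cons.1 hE
    rw [← ih hE'.2, hfilter, ← List.map_map,
      succ_filter_ne (by rw [passages_map_filter]; exact hW.filter _),
      labellingsLift_swap_mul_iff hE'.1]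

theorem labellingsLift_filter_iff (hW : (passages W).Nodup) {P : Passage → Bool}
    (hP : ∀ p ∈ passages W, p.1 ∈ C → P p) :
    R.LabellingsLift (succ (W.map (List.filter P))) C ↔ R.LabellingsLift (succ W) C := by
  rw [← labellingsLift_filter_notMem_iff hW ((passages W).filter (!P ·)) (by
    simp only [List.mem_filter]
    intro p hp hpC
    simp [hP p hp.1 hpC] at hp)]
  have : W.map (List.filter P) = W.map (List.filter (· ∉ (passages W).filter (!P ·))) := by
    refine List.map_congr_left fun w hw => List.filter_congr fun p hp => ?_
    simp [mem_passages.2 ⟨w, hw, hp⟩]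
  rw [this]

end Switch

variable {T : LinkTheory}

namespace Diagram

section LabellingsLift

variable {D D' : Diagram T} {p q : Passage} {c x y z v : ℕ} {r : Bool} {C C' : Finset ℕ}

theorem hasCrossing_of_mem (hp : p ∈ passages D.words) : D.HasCrossing p.1 := by
  obtain ⟨c, _ | _⟩ := p
  · exact D.opp_mem _ hp
  · exact hp

theorem HasCrossing.mem (hc : D.HasCrossing c) (e : Bool) : (c, e) ∈ passages D.words := by
  cases e
  · exact D.opp_mem _ hc
  · exact hc

theorem succ_mem (hp : p ∈ passages D.words) : succ D.words p ∈ passages D.words := by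
  obtain ⟨w, hw, hpw⟩ := mem_passages.1 hp
  exact mem_passages.2 ⟨w, hw, (succ_mem_iff_of_mem D.nodup hw).2 hpw⟩

theorem Next.hasCrossing_left (h : D.Next p q) : D.HasCrossing p.1 :=
  hasCrossing_of_mem h.1

theorem Next.hasCrossing_right (h : D.Next p q) : D.HasCrossing q.1 :=
  hasCrossing_of_mem (h.2 ▸ succ_mem h.1)

/-- The classical crossings that occur in the diagram. -/
def classicalCrossings (D : Diagram T) : Finset ℕ :=
  ((passages D.words).map Prod.fst).toFinset.filter fun c => (D.info c).isSome

theorem mem_classicalCrossings :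
    c ∈ D.classicalCrossings ↔ D.HasCrossing c ∧ (D.info c).isSome := by
  rw [classicalCrossings, Finset.mem_filter, List.mem_toFinset, List.mem_map]
  refine and_congr_left fun _ => ⟨?_, fun h => ⟨_, h, rfl⟩⟩
  rintro ⟨p, hp, rfl⟩
  exact hasCrossing_of_mem hp

theorem HasCrossing.mem_classicalCrossings (hc : D.HasCrossing c) :
    c ∈ D.classicalCrossings ↔ (D.info c).isSome :=
  Diagram.mem_classicalCrossings.trans (and_iff_right hc)

variable (R : Switch Λ X)

/-- Every labelling of the components of the diagram is the labelling of a colouring by `R`. For the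
smoothing switch this is the evenness of the diagram. -/
def LabellingsLift (D : Diagram T) : Prop :=
  R.LabellingsLift (succ D.words) D.classicalCrossings

theorem IsErasure.hasCrossing_iff {s : Finset ℕ} (h : IsErasure s D D') :
    D.HasCrossing c ↔ D'.HasCrossing c ∧ c ∉ s := by
  rw [HasCrossing, h.1, passages_map_filter, List.mem_filter, decide_eq_true_eq, HasCrossing]

theorem IsErasure.labellingsLift_iff {s : Finset ℕ} (h : IsErasure s D D') :
    D.LabellingsLift R ↔ R.LabellingsLift (succ D'.words) (D'.classicalCrossings \ s) := by
  have hC : D.classicalCrossings = D'.classicalCrossings \ s := by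
    ext c
    rw [Finset.mem_sdiff, mem_classicalCrossings, mem_classicalCrossings, and_right_comm,
      ← h.hasCrossing_iff]
    exact and_congr_right fun hc => by rw [h.2 c hc]
  rw [LabellingsLift, hC, h.1]
  exact Switch.labellingsLift_filter_iff D'.nodup fun p _ hp =>
    decide_eq_true (Finset.mem_sdiff.1 hp).2

theorem R1.labellingsLift_iff (h : R1 D D') : D.LabellingsLift R ↔ D'.LabellingsLift R := by
  obtain ⟨c, r, ⟨-, hkink⟩, -, herase⟩ := h
  rw [herase.labellingsLift_iff]
  exact ⟨fun h => h.kink hkink fun d hd => by simp [hd],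
    fun h => h.kink hkink fun d hd => by simp [hd]⟩

theorem CoherentBigon.succ_apply (h : D.CoherentBigon x y r) (e : Bool) :
    succ D.words (x, e) = (y, !e) := by
  obtain rfl | rfl := Bool.eq_or_eq_not e r
  · exact h.2.1.2
  · rw [Bool.not_not]
    exact h.2.2.2

theorem BraidLikeR2.labellingsLift_iff (h : BraidLikeR2 D D') :
    D.LabellingsLift R ↔ D'.LabellingsLift R := by
  obtain ⟨x, y, r, hbigon, ⟨i, j, hi, hj, -⟩, herase⟩ := h
  have hx : x ∈ D'.classicalCrossings :=
    hbigon.2.1.hasCrossing_left.mem_classicalCrossings.2 (by simp [hi])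
  have hy : y ∈ D'.classicalCrossings :=
    hbigon.2.1.hasCrossing_right.mem_classicalCrossings.2 (by simp [hj])
  have hR (a b : X) :
      R.cross (D'.classicalCrossings \ {x, y}) y (R.cross (D'.classicalCrossings \ {x, y}) x a b)
        (R.cross (D'.classicalCrossings \ {x, y}) x b a) =
      R.cross D'.classicalCrossings y (R.cross D'.classicalCrossings x a b)
        (R.cross D'.classicalCrossings x b a) := by
    rw [Switch.cross_of_mem hx, Switch.cross_of_mem hx, Switch.cross_of_mem hy, R.out_out_out,
      Switch.cross_of_notMem (by simp), Switch.cross_of_notMem (by simp)]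
  rw [herase.labellingsLift_iff]
  exact ⟨fun h => h.coherentBigon hbigon.1 hbigon.succ_apply
      (fun c hcx hcy => by simp [hcx, hcy]) fun a b => (hR a b).symm,
    fun h => h.coherentBigon hbigon.1 hbigon.succ_apply (fun c hcx hcy => by simp [hcx, hcy]) hR⟩

theorem labellingsLift_of_exchange {R : Switch Λ X}
    (hbigon : D.CoherentBigon z v r ∨ D.CoherentBigon v z r ∨ D.IncoherentBigon z v r)
    (hz : z ∈ C) (hv : v ∉ C) (hz' : z ∉ C') (hv' : v ∈ C')
    (hC : ∀ c ≠ z, c ≠ v → (c ∈ C' ↔ c ∈ C)) (h : R.LabellingsLift (succ D.words) C) :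
    R.LabellingsLift (succ D.words) C' := by
  rcases hbigon with hzv | hvz | hzv
  · refine h.coherentBigon hzv.1 hzv.succ_apply hC fun a b => ?_
    simp only [Switch.cross_of_mem, Switch.cross_of_notMem, hz, hv, hz', hv', not_false_eq_true]
  · refine h.coherentBigon hvz.1 hvz.succ_apply (fun c hcv hcz => hC c hcz hcv) fun a b => ?_
    simp only [Switch.cross_of_mem, Switch.cross_of_notMem, hz, hv, hz', hv', not_false_eq_true]
  · exact h.incoherentBigon hzv.1 hzv.2.1.2 hzv.2.2.2 hz hv hz' hv' hC

theorem Virtualization.labellingsLift_iff (h : Virtualization D D') :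
    D.LabellingsLift R ↔ D'.LabellingsLift R := by
  obtain ⟨z, v, r, hbigon, ⟨i, hz⟩, hv, hwords, hinfo⟩ := h
  have hcross : D.HasCrossing z ∧ D.HasCrossing v := by
    rcases hbigon with h | h | h
    exacts [⟨h.2.1.hasCrossing_left, h.2.1.hasCrossing_right⟩,
      ⟨h.2.1.hasCrossing_right, h.2.1.hasCrossing_left⟩,
      ⟨h.2.1.hasCrossing_left, h.2.1.hasCrossing_right⟩]
  have hmem (c : ℕ) :
      c ∈ D'.classicalCrossings ↔ D.HasCrossing c ∧ (D.info (Equiv.swap z v c)).isSome := by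
    rw [mem_classicalCrossings, HasCrossing, hwords]
    exact and_congr_right fun hc => by rw [hinfo c hc]
  have hzC : z ∈ D.classicalCrossings := hcross.1.mem_classicalCrossings.2 (by simp [hz])
  have hvC : v ∉ D.classicalCrossings := by simp [mem_classicalCrossings, hv]
  have hzC' : z ∉ D'.classicalCrossings := by simp [hmem, hv]
  have hvC' : v ∈ D'.classicalCrossings := by simp [hmem, hz, hcross.2]
  have hC : ∀ c ≠ z, c ≠ v → (c ∈ D'.classicalCrossings ↔ c ∈ D.classicalCrossings) :=
    fun c hcz hcv => by
      rw [hmem, Equiv.swap_apply_of_ne_of_ne hcz hcv, mem_classicalCrossings]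
  rw [LabellingsLift, LabellingsLift, hwords]
  refine ⟨labellingsLift_of_exchange hbigon hzC hvC hzC' hvC' hC,
    labellingsLift_of_exchange (r := r) ?_ hvC' hzC' hvC hzC fun c hcv hcz => (hC c hcz hcv).symm⟩
  rcases hbigon with h | h | h
  exacts [.inr (.inl h), .inl h, .inr (.inr ⟨h.1.symm, h.2.2, h.2.1⟩)]

/-- The Gauss code in the usual sense, which ignores the virtual crossings. -/
def gaussCode (D : Diagram T) : List (List Passage) :=
  D.words.map (List.filter fun p => (D.info p.1).isSome)

theorem classicalCrossings_eq_gaussCode :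
    D.classicalCrossings = ((passages D.gaussCode).map Prod.fst).toFinset := by
  ext c
  simp only [classicalCrossings, gaussCode, passages_map_filter, Finset.mem_filter,
    List.mem_toFinset, List.mem_map, List.mem_filter]
  exact ⟨fun ⟨⟨p, hp, hpc⟩, hc⟩ => ⟨p, ⟨hp, hpc ▸ hc⟩, hpc⟩,
    fun ⟨p, ⟨hp, hc⟩, hpc⟩ => ⟨⟨p, hp, hpc⟩, hpc ▸ hc⟩⟩

theorem labellingsLift_iff_gaussCode :
    D.LabellingsLift R ↔ R.LabellingsLift (succ D.gaussCode) D.classicalCrossings :=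
  (Switch.labellingsLift_filter_iff D.nodup fun _ _ hp => (mem_classicalCrossings.1 hp).2).symm

theorem gaussCode_eq_offArc {A u : List Passage} {L : List (List Passage)}
    (hwords : D.words = (A ++ u) :: L) (hu : ∀ p ∈ u, D.info p.1 = none) :
    D.gaussCode =
      (offArc u A :: L.map (offArc u)).map (List.filter fun p => (D.info p.1).isSome) := by
  have hoff (w : List Passage) : (offArc u w).filter (fun p => (D.info p.1).isSome) =
      w.filter fun p => (D.info p.1).isSome := by
    rw [offArc, List.filter_filter]
    refine List.filter_congr fun p _ => ?_
    rw [Bool.and_eq_left_iff_imp, decide_eq_true_eq, List.mem_map]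
    rintro hp ⟨q, hq, hqp⟩
    simp [← hqp, hu q hq] at hp
  have hu' : u.filter (fun p => (D.info p.1).isSome) = [] :=
    List.filter_eq_nil_iff.2 fun p hp => by simp [hu p hp]
  rw [gaussCode, hwords, List.map_cons, List.map_cons, List.map_map, List.filter_append, hu',
    List.append_nil, hoff]
  exact congrArg _ (List.map_congr_left fun w _ => (hoff w).symm)

theorem Detour.gaussCode_eq (h : Detour D D') : D.gaussCode = D'.gaussCode := by
  obtain ⟨A, u, A', u', L, L', hD, hD', hu, hu', hA, hL, hinfo⟩ := h
  rw [gaussCode_eq_offArc hD hu, gaussCode_eq_offArc hD' hu', ← hA, ← hL, ← List.map_cons]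
  refine List.map_congr_left fun w hw => List.filter_congr fun p hp => ?_
  obtain ⟨v, hv, rfl⟩ := List.mem_map.1 hw
  simp only [offArc, List.mem_filter, decide_eq_true_eq] at hp
  rw [hinfo p.1 (hasCrossing_of_mem (mem_passages.2 ?_)) hp.2]
  rcases List.mem_cons.1 hv with rfl | hv
  · exact ⟨v ++ u, by simp [hD], by simp [hp.1]⟩
  · exact ⟨v, by simp [hD, hv], hp.1⟩

theorem Detour.labellingsLift_iff (h : Detour D D') :
    D.LabellingsLift R ↔ D'.LabellingsLift R := by
  rw [labellingsLift_iff_gaussCode, labellingsLift_iff_gaussCode, classicalCrossings_eq_gaussCode,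
    classicalCrossings_eq_gaussCode, h.gaussCode_eq]

theorem IsTripleSwap.hasCrossing_iff {a b c d : ℕ} (hab : a ≠ b) (hac : a ≠ c) (hbc : b ≠ c)
    (h : IsTripleSwap (a, r) (b, r) (a, !r) (c, r) (b, !r) (c, !r) D D') (ha : D.HasCrossing a)
    (hb : D.HasCrossing b) (hc : D.HasCrossing c) : D'.HasCrossing d ↔ D.HasCrossing d := by
  have hmem (p : Passage) :
      triangleSwap a b c r p ∈ passages D'.words ↔ p ∈ passages D.words := by
    rw [h.1, passages_map_map]
    exact List.mem_map_of_injective (triangleSwap a b c r).injective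
  by_cases hd : d ∈ ({a, b, c} : Finset ℕ)
  · obtain ⟨ta, ta', tb, -, -, -⟩ := triangleSwap_apply (r := r) hab hac hbc
    have ha' := hasCrossing_of_mem ((hmem (b, r)).2 (hb.mem r))
    have hb' := hasCrossing_of_mem ((hmem (a, r)).2 (ha.mem r))
    have hc' := hasCrossing_of_mem ((hmem (a, !r)).2 (ha.mem _))
    rw [tb] at ha'
    rw [ta] at hb'
    rw [ta'] at hc'
    simp only [Finset.mem_insert, Finset.mem_singleton] at hd
    rcases hd with rfl | rfl | rfl
    exacts [iff_of_true ha' ha, iff_of_true hb' hb, iff_of_true hc' hc]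
  · rw [HasCrossing, HasCrossing, ← hmem, triangleSwap_apply_of_notMem hd]

theorem BraidLikeR3.labellingsLift_iff (h : BraidLikeR3 D D') :
    D.LabellingsLift R ↔ D'.LabellingsLift R := by
  obtain ⟨a, b, c, r, hab, hac, hbc, h₁, h₂, h₃, ⟨i, j, k, hi, hj, hk, -⟩, hswap⟩ := h
  have ha := h₁.hasCrossing_left
  have hb := h₁.hasCrossing_right
  have hc := h₂.hasCrossing_right
  have hC : D'.classicalCrossings = D.classicalCrossings := by
    ext d
    rw [mem_classicalCrossings, mem_classicalCrossings,
      hswap.hasCrossing_iff hab hac hbc ha hb hc]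
    exact and_congr_right fun hd => by rw [hswap.2 d hd]
  rw [LabellingsLift, LabellingsLift, hC]
  refine (Switch.labellingsLift_triangle_iff hab hac hbc h₁.2 h₂.2 h₃.2
    (ha.mem_classicalCrossings.2 ?_) (hb.mem_classicalCrossings.2 ?_)
    (hc.mem_classicalCrossings.2 ?_) fun p => ?_).symm
  · simp [hi]
  · simp [hj]
  · simp [hk]
  · rw [hswap.1]
    exact succ_map_apply ..

theorem Iso.labellingsLift_iff (h : Iso D D') : D.LabellingsLift R ↔ D'.LabellingsLift R := by
  obtain ⟨e, hperm, hinfo⟩ := h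
  set E : Equiv.Perm Passage := e.prodCongr (Equiv.refl Bool)
  have hcycles : ((D.words.map (List.map E)).map ((↑) : List Passage → Cycle Passage)).Perm
      (D'.words.map (↑)) := by
    simp only [List.pure_def, List.bind_eq_flatMap, ← List.map_eq_flatMap, List.map_id'] at hperm
    rw [List.map_map]
    exact hperm
  have hnodup : (passages (D.words.map (List.map E))).Nodup := by
    rw [passages_map_map]
    exact D.nodup.map E.injective
  have hmem (p : Passage) : E p ∈ passages D'.words ↔ p ∈ passages D.words := by
    rw [mem_passages_iff_cycle]
    simp_rw [← hcycles.mem_iff]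
    rw [← mem_passages_iff_cycle, passages_map_map, List.mem_map_of_injective E.injective]
  refine (Switch.labellingsLift_rename_iff (e := e) (fun p => ?_) fun c => ?_).symm
  · rw [← succ_eq_of_cycle_perm hnodup D'.nodup hcycles]
    exact succ_map_apply E D.words p
  · rw [mem_classicalCrossings, mem_classicalCrossings, HasCrossing, HasCrossing,
      ← hmem (c, true)]
    exact and_congr_right fun hc => by rw [hinfo c ((hmem (c, true)).1 hc)]

theorem BraidLikeMove.labellingsLift_iff (h : BraidLikeMove D D') :
    D.LabellingsLift R ↔ D'.LabellingsLift R := by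
  cases h with
  | iso h => exact h.labellingsLift_iff R
  | r1 h => exact h.labellingsLift_iff R
  | r2 h => exact h.labellingsLift_iff R
  | r3 h => exact h.labellingsLift_iff R
  | detour h => exact h.labellingsLift_iff R
  | virtualization _ h => exact h.labellingsLift_iff R

theorem BraidLikeEquivalent.labellingsLift_iff (h : BraidLikeEquivalent D D') :
    D.LabellingsLift R ↔ D'.LabellingsLift R := by
  induction h with
  | rel _ _ h => exact h.labellingsLift_iff R
  | refl => exact Iff.rfl
  | symm _ _ _ ih => exact ih.symm
  | trans _ _ _ _ _ ih₁ ih₂ => exact ih₁.trans ih₂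

end LabellingsLift

end Diagram

section Chain

variable {α β : Type*} {l : List α} {a b : α}

theorem apply_eq_of_isChain {g : α → β} (hl : l.IsChain fun a b => g a = g b) (ha : a ∈ l)
    (hb : b ∈ l) : g a = g b := by
  have hmap : (l.map g).IsChain (· = ·) := (List.isChain_map g).2 hl
  exact (List.isChain_iff_pairwise.1 hmap).forall_of_forall (fun _ _ => rfl)
    (List.mem_map_of_mem ha) (List.mem_map_of_mem hb)

theorem quot_mk_eq_of_isChain {S : α → Prop} {r : α → α → Prop} (hl : l.IsChain r)
    (hS : ∀ a ∈ l, S a) (ha : a ∈ l) (hb : b ∈ l) :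
    Quot.mk (fun s t : {a // S a} => r s.1 t.1) ⟨a, hS a ha⟩ = Quot.mk _ ⟨b, hS b hb⟩ := by
  classical
  let g (a : α) : Option (Quot fun s t : {a // S a} => r s.1 t.1) :=
    if h : S a then some (Quot.mk _ ⟨a, h⟩) else none
  have hg {a : α} (h : S a) : g a = some (Quot.mk _ ⟨a, h⟩) := dif_pos h
  have hchain : l.IsChain fun a b => g a = g b := hl.imp_of_mem_imp fun a b ha hb hab => by
    rw [hg (hS a ha), hg (hS b hb)]
    exact congrArg some (Quot.sound hab)
  simpa only [hg (hS a ha), hg (hS b hb), Option.some_inj] using apply_eq_of_isChain hchain ha hb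

/-- The lists in `F` are the classes of the equivalence relation on the members of `S` that is
generated by the steps. Each list has to follow the steps, and may visit an element repeatedly. -/
def ListsClasses (S : List α) (step : α → List α) (F : List (List α)) : Prop :=
  [] ∉ F ∧ F.Pairwise (fun l l' => ∀ a ∈ l, a ∉ l') ∧ S ⊆ F.flatten ∧ F.flatten ⊆ S ∧
    ∀ l ∈ F, (l.IsChain fun a b => b ∈ step a) ∧ ∀ a ∈ l, step a ⊆ l

instance [DecidableEq α] (S : List α) (step : α → List α) (F : List (List α)) :
    Decidable (ListsClasses S step F) := by
  unfold ListsClasses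
  infer_instance

theorem ListsClasses.existsUnique_mem {S : List α} {step : α → List α} {F : List (List α)}
    (hF : ListsClasses S step F) (ha : a ∈ S) : ∃! i : Fin F.length, a ∈ F[i] := by
  obtain ⟨-, hdisj, hsub, -⟩ := hF
  obtain ⟨l, hl, hal⟩ := List.mem_flatten.1 (hsub ha)
  obtain ⟨i, hi, rfl⟩ := List.getElem_of_mem hl
  refine ⟨⟨i, hi⟩, hal, fun j haj => ?_⟩
  by_contra hij
  rw [List.pairwise_iff_getElem] at hdisj
  rcases lt_or_gt_of_ne (fun h => hij (Fin.ext h) : (j : ℕ) ≠ i) with h | h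
  · exact hdisj _ _ _ _ h a haj hal
  · exact hdisj _ _ _ _ h a hal haj

theorem ListsClasses.card_quot {S : List α} {step : α → List α} {F : List (List α)}
    (hF : ListsClasses S step F) {P : α → Prop} (hP : ∀ a, P a ↔ a ∈ S) {r : α → α → Prop}
    (hr : ∀ a b, r a b ↔ b ∈ step a) :
    Nat.card (Quot fun s t : {a // P a} => r s.1 t.1) = F.length := by
  obtain rfl : P = (· ∈ S) := funext fun a => propext (hP a)
  obtain rfl : r = fun a b => b ∈ step a := funext₂ fun a b => propext (hr a b)
  choose g hg huniq using fun s : {a // a ∈ S} => hF.existsUnique_mem s.2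
  obtain ⟨hne, -, -, hsub, hsteps⟩ := hF
  have hS (i : Fin F.length) : ∀ a ∈ F[i], a ∈ S := fun a ha =>
    hsub (List.mem_flatten.2 ⟨_, List.getElem_mem _, ha⟩)
  have hstep (s t : {a // a ∈ S}) (hst : t.1 ∈ step s.1) : g s = g t :=
    huniq t (g s) ((hsteps _ (List.getElem_mem _)).2 _ (hg s) hst)
  have hbij : Function.Bijective (Quot.lift g hstep) := by
    refine ⟨?_, fun i => ?_⟩
    · rintro ⟨s⟩ ⟨t⟩ (hst : g s = g t)
      exact quot_mk_eq_of_isChain (r := fun a b => b ∈ step a) (hsteps _ (List.getElem_mem _)).1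
        (hS (g s)) (hg s) (hst ▸ hg t)
    · obtain ⟨a, ha⟩ := List.exists_mem_of_ne_nil F[i] fun h => hne (h ▸ List.getElem_mem _)
      exact ⟨Quot.mk _ ⟨a, hS i a ha⟩, (huniq ⟨a, hS i a ha⟩ i ha).symm⟩
  rw [Nat.card_eq_of_bijective _ hbij, Nat.card_fin]

end Chain

section Planar

variable {W : List (List Passage)}

theorem isPlanar_of_listsClasses {F : List (List (Passage × Bool))} {P : List (List Passage)}
    (hF : ListsClasses (passages W ×ˢ [true, false]) (fun s => [faceStep W s]) F)
    (hP : ListsClasses (passages W) (fun p => [succ W p, opp p]) P)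
    (h : 2 * F.length = (passages W).length + 4 * P.length) : IsPlanar W := by
  have hmem (s : Passage × Bool) : s.1 ∈ passages W ↔ s ∈ passages W ×ˢ [true, false] := by
    cases s with | mk p e => cases e <;> simp
  have hface : Nat.card (Face W) = F.length :=
    hF.card_quot (r := fun s t => faceStep W s = t) hmem (by simp [eq_comm])
  have hpiece : Nat.card (Piece W) = P.length :=
    hP.card_quot (r := fun p q => succ W p = q ∨ opp p = q) (fun _ => Iff.rfl) (by simp [eq_comm])
  rw [IsPlanar, hface, hpiece, h]

theorem apply_eq_of_mem_word {β : Type*} {κ : Passage → β} (hκ : ∀ p, κ (succ W p) = κ p)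
    (hW : (passages W).Nodup) {w : List Passage} (hw : w ∈ W) {p q : Passage} (hp : p ∈ w)
    (hq : q ∈ w) : κ p = κ q := by
  refine apply_eq_of_isChain (List.isChain_iff_getElem.2 fun i hi => ?_) hp hq
  rw [← List.formPerm_apply_lt_getElem w (nodup_of_mem hW hw) i hi,
    ← succ_apply hW hw (List.getElem_mem _), hκ]

end Planar

namespace Diagram

theorem labellingsLift_of_pair {R : Switch Λ X} {D : Diagram T} {v w : List Passage}
    (hD : D.words = [v, w]) (hv : v ≠ []) (hw : w ≠ []) (F : Λ → Λ → Passage → X)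
    (hlabel : ∀ x y, (∀ p ∈ v, R.label (F x y p) = x) ∧ ∀ p ∈ w, R.label (F x y p) = y)
    (hF : ∀ x y, ∀ p ∈ passages D.words,
      F x y (succ D.words p) = R.cross D.classicalCrossings p.1 (F x y p) (F x y (opp p))) :
    D.LabellingsLift R := by
  classical
  intro κ hκ
  obtain ⟨p₀, hp₀⟩ := List.exists_mem_of_ne_nil v hv
  obtain ⟨q₀, hq₀⟩ := List.exists_mem_of_ne_nil w hw
  choose g hg using R.label_surjective
  refine ⟨fun p => if p ∈ passages D.words then F (κ p₀) (κ q₀) p else g (κ p), fun p => ?_,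
    fun p => ?_⟩ <;> by_cases hp : p ∈ passages D.words <;> dsimp only
  · rw [if_pos hp]
    have hword {u : List Passage} (hu : u ∈ D.words) {p q : Passage} (hp : p ∈ u) (hq : q ∈ u) :
        κ p = κ q := apply_eq_of_mem_word hκ D.nodup hu hp hq
    obtain hpv | hpw : p ∈ v ∨ p ∈ w := by simpa [hD, passages] using hp
    · rw [(hlabel _ _).1 p hpv, hword (by simp [hD]) hp₀ hpv]
    · rw [(hlabel _ _).2 p hpw, hword (by simp [hD]) hq₀ hpw]
  · rw [if_neg hp, hg]
  · rw [if_pos hp, if_pos (succ_mem hp), if_pos (D.opp_mem p hp), hF _ _ p hp]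
  · have hpC : p.1 ∉ D.classicalCrossings := fun h => hp ((mem_classicalCrossings.1 h).1.mem p.2)
    rw [succ_apply_of_notMem hp, Switch.cross_of_notMem hpC]

theorem LabellingsLift.exists_isColouring {X : Type*} {R : Switch Bool X} {D : Diagram T}
    (h : D.LabellingsLift R) {w : List Passage} (hw : w ∈ D.words) :
    ∃ f, (∀ p, R.label (f p) = decide (p ∈ w)) ∧
      R.IsColouring (succ D.words) D.classicalCrossings f :=
  h _ fun _ => decide_eq_decide.2 (succ_mem_iff_of_mem D.nodup hw)

end Diagram

namespace Switch.IsColouring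

variable {σ : Equiv.Perm Passage} {C : Finset ℕ} {f : Passage → Bool × Bool} {p q : Passage}

theorem smoothingSwitch_apply_of_eq (hf : smoothingSwitch.IsColouring σ C f) (hσ : σ p = q)
    (hp : p.1 ∈ C) (h : (f p).1 = (f (opp p)).1) : f q = f (opp p) := by
  rw [← hσ, hf, cross_of_mem hp]
  exact if_pos h

theorem smoothingSwitch_apply_of_ne (hf : smoothingSwitch.IsColouring σ C f) (hσ : σ p = q)
    (hp : p.1 ∈ C) (h : (f p).1 ≠ (f (opp p)).1) : f q = ((f p).1, !(f p).2) := by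
  rw [← hσ, hf, cross_of_mem hp]
  exact if_neg h

end Switch.IsColouring

namespace LinkTheory

/-- Crossing data for which the strand `e` may be regarded as the upper one. -/
def datum : (T : LinkTheory) → Bool → T.Info
  | .virtual, e => e
  | .flat, _ => ()
  | .free, _ => ()

theorem above_datum (T : LinkTheory) (e : Bool) : T.Above (T.datum e) e := by
  cases T <;> trivial

end LinkTheory

/-- The crossing data of the examples: `1` and `3` are virtual, the other crossings classical. The
value at `5` is the one that the unoriented moves at the crossings `4`, `5` and `6` require. -/
def exampleInfo (T : LinkTheory) (c : ℕ) : Option T.Info :=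
  if c = 1 ∨ c = 3 then none else some (T.datum (c ≠ 5))

/-- Two circles that meet in four points, alternately classical and virtual. -/
def twoCircles (T : LinkTheory) : Diagram T where
  words := [[(0, false), (1, true), (2, false), (3, true)],
    [(0, true), (1, false), (2, true), (3, false)]]
  info := exampleInfo T
  nodup := by decide
  opp_mem := by decide
  planar := isPlanar_of_listsClasses
    (F := [[((0, false), true), ((1, false), true), ((2, false), true), ((3, false), true)],
      [((0, false), false), ((0, true), true)], [((1, true), true), ((1, false), false)],
      [((1, true), false), ((0, true), false), ((3, true), false), ((2, true), false)],
      [((2, false), false), ((2, true), true)], [((3, true), true), ((3, false), false)]])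
    (P := [[(0, false), (1, true), (2, false), (3, true), (3, false), (0, true), (1, false),
      (2, true)]])
    (by decide) (by decide) rfl

/-- `twoCircles` after an unoriented second Reidemeister move across the central face. -/
def twoCirclesWithBigon (T : LinkTheory) : Diagram T where
  words := [[(0, false), (4, true), (5, false), (1, true), (2, false), (5, true), (4, false),
    (3, true)], [(0, true), (1, false), (2, true), (3, false)]]
  info := exampleInfo T
  nodup := by decide
  opp_mem := by decide
  planar := isPlanar_of_listsClasses
    (F := [[((0, false), true), ((4, false), true), ((3, false), true)],
      [((0, false), false), ((0, true), true), ((5, false), false), ((5, true), true)],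
      [((4, true), true), ((2, false), false), ((2, true), true), ((4, false), false)],
      [((4, true), false), ((5, true), false)],
      [((5, false), true), ((1, false), true), ((2, false), true)],
      [((1, true), true), ((1, false), false)],
      [((1, true), false), ((0, true), false), ((3, true), false), ((2, true), false)],
      [((3, true), true), ((3, false), false)]])
    (P := [[(0, false), (4, true), (5, false), (1, true), (2, false), (5, true), (4, false),
      (3, true), (3, false), (0, true), (1, false), (2, true)]])
    (by decide) (by decide) rfl

/-- A circle with kinks at the vertices of a directed triangle; a second circle meets two of the
kinks, each in a classical and a virtual crossing. -/
def directedTriangle (T : LinkTheory) : Diagram T where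
  words := [[(4, true), (5, false), (0, true), (1, false), (5, true), (6, false), (2, true),
    (3, false), (6, true), (4, false)], [(0, false), (1, true), (2, false), (3, true)]]
  info := exampleInfo T
  nodup := by decide
  opp_mem := by decide
  planar := isPlanar_of_listsClasses
    (F := [[((4, true), true), ((1, false), false), ((1, true), true), ((6, false), false),
        ((6, true), true), ((4, false), false)],
      [((4, true), false), ((6, true), false), ((5, true), false)],
      [((5, false), true), ((0, false), true), ((1, false), true)],
      [((5, false), false), ((5, true), true), ((3, false), false), ((3, true), true)],
      [((0, true), true), ((0, false), false)],
      [((0, true), false), ((3, true), false), ((2, true), false), ((1, true), false)],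
      [((6, false), true), ((2, false), true), ((3, false), true)],
      [((2, true), true), ((2, false), false)], [((4, false), true)]])
    (P := [[(4, true), (5, false), (0, true), (1, false), (5, true), (6, false), (2, true),
      (3, false), (6, true), (4, false), (4, true), (5, false), (0, true), (0, false), (1, true),
      (2, false), (3, true)]])
    (by decide) (by decide) rfl

/-- `directedTriangle` after an unoriented third Reidemeister move. -/
def reversedTriangle (T : LinkTheory) : Diagram T where
  words := [[(5, false), (4, true), (0, true), (1, false), (6, false), (5, true), (2, true),
    (3, false), (4, false), (6, true)], [(0, false), (1, true), (2, false), (3, true)]]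
  info := exampleInfo T
  nodup := by decide
  opp_mem := by decide
  planar := isPlanar_of_listsClasses
    (F := [[((5, false), true), ((4, false), true), ((6, false), true)],
      [((5, false), false), ((5, true), true), ((2, false), true), ((3, false), true)],
      [((4, true), true), ((0, false), true), ((1, false), true), ((4, false), false)],
      [((4, true), false), ((3, false), false), ((3, true), true)],
      [((0, true), true), ((0, false), false)],
      [((0, true), false), ((3, true), false), ((2, true), false), ((1, true), false)],
      [((1, false), false), ((1, true), true), ((5, true), false), ((6, true), false)],
      [((6, false), false), ((6, true), true)], [((2, true), true), ((2, false), false)]])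
    (P := [[(5, false), (4, true), (0, true), (1, false), (6, false), (5, true), (2, true),
      (3, false), (4, false), (6, true), (5, false), (4, true), (0, true), (0, false), (1, true),
      (2, false), (3, true)]])
    (by decide) (by decide) rfl

theorem unorientedR2_twoCircles (T : LinkTheory) :
    (twoCircles T).UnorientedR2 (twoCirclesWithBigon T) :=
  ⟨4, 5, true, ⟨by decide, ⟨by simp [twoCirclesWithBigon, passages], rfl⟩,
    by simp [twoCirclesWithBigon, passages], rfl⟩,
    ⟨T.datum true, T.datum false, rfl, rfl, Or.inl ⟨T.above_datum _, T.above_datum _⟩⟩,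
    rfl, fun _ _ => rfl⟩

theorem unorientedR3_directedTriangle (T : LinkTheory) :
    (directedTriangle T).UnorientedR3 (reversedTriangle T) :=
  ⟨4, 5, 6, true, by decide, by decide, by decide,
    ⟨by simp [directedTriangle, passages], rfl⟩, ⟨by simp [directedTriangle, passages], rfl⟩,
    ⟨by simp [directedTriangle, passages], rfl⟩,
    ⟨T.datum true, T.datum false, T.datum true, rfl, rfl, rfl,
      Or.inl ⟨T.above_datum _, T.above_datum _⟩⟩, rfl, fun _ _ => rfl⟩

theorem labellingsLift_twoCircles (T : LinkTheory) :
    (twoCircles T).LabellingsLift smoothingSwitch :=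
  Diagram.labellingsLift_of_pair rfl (List.cons_ne_nil _ _) (List.cons_ne_nil _ _)
    (fun x y p => (if p ∈ [((0 : ℕ), false), (1, true), (2, false), (3, true)] then x else y,
      (x != y) && (p.1 == 1 || p.1 == 2)))
    (by decide) (by cases T <;> decide)

theorem not_labellingsLift_twoCirclesWithBigon (T : LinkTheory) :
    ¬(twoCirclesWithBigon T).LabellingsLift smoothingSwitch := by
  intro h
  obtain ⟨f, hlabel, hf⟩ := h.exists_isColouring
    (w := [(0, true), (1, false), (2, true), (3, false)]) (by simp [twoCirclesWithBigon])
  change ∀ p, (f p).1 = _ at hlabel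
  have hC : (twoCirclesWithBigon T).classicalCrossings = {0, 2, 4, 5} := by cases T <;> decide
  rw [hC] at hf
  have h_smooth : f (1, true) = f (5, true) :=
    hf.smoothingSwitch_apply_of_eq (p := (5, false)) rfl (by decide) (by simp [hlabel, opp])
  have h_virtual : f (2, false) = f (1, true) := hf.apply_of_notMem rfl (by decide)
  have h_mixed : f (5, true) = ((f (2, false)).1, !(f (2, false)).2) :=
    hf.smoothingSwitch_apply_of_ne (p := (2, false)) rfl (by decide) (by simp [hlabel, opp])
  rw [h_virtual, h_smooth] at h_mixed
  exact Bool.self_ne_not _ (congrArg Prod.snd h_mixed)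

theorem not_labellingsLift_directedTriangle (T : LinkTheory) :
    ¬(directedTriangle T).LabellingsLift smoothingSwitch := by
  intro h
  obtain ⟨f, hlabel, hf⟩ := h.exists_isColouring
    (w := [(0, false), (1, true), (2, false), (3, true)]) (by simp [directedTriangle])
  change ∀ p, (f p).1 = _ at hlabel
  have hC : (directedTriangle T).classicalCrossings = {0, 2, 4, 5, 6} := by cases T <;> decide
  rw [hC] at hf
  have h_smooth : f (0, true) = f (5, true) :=
    hf.smoothingSwitch_apply_of_eq (p := (5, false)) rfl (by decide) (by simp [hlabel, opp])
  have h_mixed : f (1, false) = ((f (0, true)).1, !(f (0, true)).2) :=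
    hf.smoothingSwitch_apply_of_ne (p := (0, true)) rfl (by decide) (by simp [hlabel, opp])
  have h_virtual : f (5, true) = f (1, false) := hf.apply_of_notMem rfl (by decide)
  rw [← h_virtual, h_smooth] at h_mixed
  exact Bool.self_ne_not _ (congrArg Prod.snd h_mixed)

theorem labellingsLift_reversedTriangle (T : LinkTheory) :
    (reversedTriangle T).LabellingsLift smoothingSwitch :=
  Diagram.labellingsLift_of_pair rfl (List.cons_ne_nil _ _) (List.cons_ne_nil _ _)
    (fun x y p => (if p ∈ [((0 : ℕ), false), (1, true), (2, false), (3, true)] then y else x,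
      (x != y) && decide
        (p ∈ [(1, false), (1, true), (2, true), (2, false), (6, false), (5, false)])))
    (by decide) (by cases T <;> decide)

end VirtualLinks

theorem mainTheorem5 (T : VirtualLinks.LinkTheory) :
    (∃ D D' : VirtualLinks.Diagram T, D.UnorientedR2 D' ∧ ¬ D.BraidLikeEquivalent D') ∧
      (∃ D D' : VirtualLinks.Diagram T, D.UnorientedR3 D' ∧ ¬ D.BraidLikeEquivalent D') :=
  ⟨⟨_, _, VirtualLinks.unorientedR2_twoCircles T, fun h =>
      VirtualLinks.not_labellingsLift_twoCirclesWithBigon T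
        ((h.labellingsLift_iff _).1 (VirtualLinks.labellingsLift_twoCircles T))⟩,
    ⟨_, _, VirtualLinks.unorientedR3_directedTriangle T, fun h =>
      VirtualLinks.not_labellingsLift_directedTriangle T
        ((h.labellingsLift_iff _).2 (VirtualLinks.labellingsLift_reversedTriangle T))⟩⟩
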